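/- Fix integers $e\ge 2$ and $\ell\ge 1$. Let $\mathcal P$ be the set of all partitions, and write $(x_1,\dots,x_\ell)^\sigma=(x_{\sigma(1)},\dots,x_{\sigma(\ell)})$ for $\sigma\in\mathfrak S_\ell$. *Residues.* For $\boldsymbol\lambda=(\lambda^{(1)},\dots,\lambda^{(\ell)})\in\mathcal P^\ell$ and $\mathbf t=(t_1,\dots,t_\ell)\in\mathbb Z^\ell$, let $\mathrm{res}_e^{\mathbf t}(\boldsymbol\lambda)$ be the multiset of the classes $b-a+t_j\in\mathbb Z/e\mathbb Z$, one for each node $(a,b,j)$ with $a\ge1$, $1\le j\le \ell$, $1\le b\le\lambda^{(j)}_a$. *$\beta$-sets.* A $\beta$-set is a set $B\subseteq\mathbb Z$ such that $\max B$ and $\min(\mathbb Z\setminus B)$ exist; its charge is $s(B)=|B\cap\mathbb Z_{\ge0}|-|\mathbb Z_{<0}\setminus B|$. For $t\in\mathbb Z$ and $\lambda\in\mathcal P$, the set $\beta_t(\lambda)=\{\lambda_a+t-a: a\ge 1\}$ is a $\beta$-set of charge $t$, and each $\beta$-set $B$ equals $\beta_{s(B)}(\lambda)$ for a unique partition $\lambda=:\beta^{-1}(B)$.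 For a $\beta$-set $B$ and $0\le i<e$ let $B_i=\{a\in\mathbb Z: ae+i\in B\}=\{b_{i1}>b_{i2}>\cdots\}$, and put $$\mathrm{core}_e(B)=\bigcup_{i=0}^{e-1}\{ae+i: a<s(B_i)\},\qquad \mathrm{wt}_e(B)=\sum_{i=0}^{e-1}\sum_{a\ge1}\bigl(b_{ia}-s(B_i)+a\bigr),$$ where the second sum has only finitely many nonzero terms. *Uglov's map.* For $1\le j\le\ell$ and $x=ae+b$ with $a,b\in\mathbb Z$, $0\le b<e$, put $\upsilon_j(x)=ae\ell+(\ell-j)e+b$. For $(\boldsymbol\lambda;\mathbf t)\in\mathcal P^\ell\times\mathbb Z^\ell$ let $U=\bigcup_{j=1}^\ell\upsilon_j\bigl(\beta_{t_j}(\lambda^{(j)})\bigr)$, which is a $\beta$-set, and define $\mathrm{core}_e(\boldsymbol\lambda;\mathbf t)=\beta^{-1}(\mathrm{core}_e(U))\in\mathcal P$ and $\mathrm{wt}_e(\boldsymbol\lambda;\mathbf t)=\mathrm{wt}_e(U)\in\mathbb Z$. *Extended affine Weyl group.* $\widehat{\mathbf W}_\ell=\mathbb Z^\ell\rtimes\mathfrak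 S_\ell$ (with respect to the right place permutation action) acts on the right on $\mathcal P^\ell\times\mathbb Z^\ell$ by $(\boldsymbol\lambda;\mathbf t)^{\sigma\mathbf u}=(\boldsymbol\lambda^\sigma;\mathbf t^\sigma+e\mathbf u)$ for $\sigma\in\mathfrak S_\ell$, $\mathbf u\in\mathbb Z^\ell$. **Theorem.** Let $\boldsymbol\lambda,\boldsymbol\mu\in\mathcal P^\ell$ and $\mathbf r\in\mathbb Z^\ell$. Then $\mathrm{res}_e^{\mathbf r}(\boldsymbol\lambda)=\mathrm{res}_e^{\mathbf r}(\boldsymbol\mu)$ if and only if both 1. $\mathrm{core}_e(\boldsymbol\lambda;\mathbf r)=\mathrm{core}_e(\boldsymbol\mu;\mathbf r)$, and 2. the minimum of $\mathrm{wt}_e$ over the orbit $(\boldsymbol\lambda;\mathbf r)^{\widehat{\mathbf W}_\ell}$ and the minimum of $\mathrm{wt}_e$ over the orbit $(\boldsymbol\mu;\mathbf r)^{\widehat{\mathbf W}_\ell}$ (which exist) are equal. -/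

import Mathlib

namespace Uglov

noncomputable section

/-! Partitions are Mathlib's Young diagrams: the diagram `lam` is the partition whose parts are
`lam.rowLen 0 ≥ lam.rowLen 1 ≥ …`.  Rows, columns, runners and components are indexed from `0`,
so a row index `a` here is the row `a + 1` of the usual convention. -/

/-! ### Beta-sets -/

/-- A beta-set: a set of integers with a largest element whose complement has a least element. -/
def IsBetaSet (B : Set ℤ) : Prop :=
  (∃ m, IsGreatest B m) ∧ (∃ m, IsLeast Bᶜ m)

/-- The charge `|B ∩ ℤ_{≥ 0}| - |ℤ_{< 0} \ B|` (both sets are finite when `B` is a beta-set). -/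
def charge (B : Set ℤ) : ℤ :=
  ((B ∩ Set.Ici 0).ncard : ℤ) - ((Set.Iio 0 \ B).ncard : ℤ)

/-- The decreasing enumeration `b 0 > b 1 > b 2 > …` of a beta-set: `b 0` is its maximum, and
`b (a + 1)` is the maximum of the elements below `b a`. -/
def enum (B : Set ℤ) : ℕ → ℤ
  | 0 => sSup B
  | a + 1 => sSup {x | x ∈ B ∧ x < enum B a}

/-- The `i`-th component of the `e`-quotient of `B`: the positions on runner `i` of the
`e`-abacus of `B`, relabelled. -/
def quot (e : ℕ) (B : Set ℤ) (i : ℕ) : Set ℤ :=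
  {a | a * (e : ℤ) + (i : ℤ) ∈ B}

/-- The `e`-core of a beta-set: all beads are pushed up their runners. -/
def coreSet (e : ℕ) (B : Set ℤ) : Set ℤ :=
  {x | ∃ i < e, ∃ a : ℤ, a < charge (quot e B i) ∧ x = a * (e : ℤ) + (i : ℤ)}

/-- The `e`-weight of a beta-set: the total number of one-step moves made when pushing all beads
up their runners (a finite sum when `B` is a beta-set, see `finite_support_weight`). -/
def wtSet (e : ℕ) (B : Set ℤ) : ℤ :=
  ∑ i ∈ Finset.range e,
    ∑ᶠ a : ℕ, (enum (quot e B i) a - charge (quot e B i) + ((a : ℤ) + 1))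

/-- The beta-set of charge `t` of a partition. -/
def beta (t : ℤ) (lam : YoungDiagram) : Set ℤ :=
  Set.range fun a : ℕ => (lam.rowLen a : ℤ) + t - ((a : ℤ) + 1)

theorem isBetaSet_of_bounds {B : Set ℤ} {N M : ℤ} (hN : ∀ x < N, x ∈ B)
    (hM : ∀ x ∈ B, x < M) : IsBetaSet B := by
  constructor
  · obtain ⟨m, hm, h⟩ := Int.exists_greatest_of_bdd (P := fun x => x ∈ B)
      ⟨M, fun z hz => (hM z hz).le⟩ ⟨N - 1, hN _ (by lia)⟩
    exact ⟨m, hm, fun x hx => h x hx⟩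
  · obtain ⟨m, hm, h⟩ := Int.exists_least_of_bdd (P := fun x => x ∉ B)
      ⟨N, fun z hz => by by_contra h; exact hz (hN z (by lia))⟩
      ⟨M, fun h => lt_irrefl _ (hM _ h)⟩
    exact ⟨m, hm, fun x hx => h x hx⟩

theorem IsBetaSet.bounds {B : Set ℤ} (hB : IsBetaSet B) :
    ∃ N M : ℤ, (∀ x < N, x ∈ B) ∧ (∀ x ∈ B, x < M) := by
  obtain ⟨⟨m, hm⟩, ⟨n, hn⟩⟩ := hB
  refine ⟨n, m + 1, fun x hx => ?_, fun x hx => ?_⟩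
  · by_contra h
    have := hn.2 h
    lia
  · have := hm.2 hx
    lia

theorem isBetaSet_beta (t : ℤ) (lam : YoungDiagram) : IsBetaSet (beta t lam) := by
  have h0 : ∀ a ≥ lam.colLen 0, lam.rowLen a = 0 := fun a ha => by
    by_contra h
    have : (a, 0) ∈ lam := YoungDiagram.mem_iff_lt_rowLen.2 (by lia)
    have := YoungDiagram.mem_iff_lt_colLen.1 this
    lia
  refine isBetaSet_of_bounds (N := t - lam.colLen 0) (M := lam.rowLen 0 + t) ?_ ?_
  · intro x hx
    refine ⟨(t - x - 1).toNat, ?_⟩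
    simp only
    rw [h0 _ (by lia)]
    lia
  · rintro x ⟨a, rfl⟩
    have := lam.rowLen_anti 0 a (by lia)
    simp only
    lia

theorem isBetaSet_quot {e : ℕ} (he : 0 < e) {B : Set ℤ} (hB : IsBetaSet B) (i : ℕ) :
    IsBetaSet (quot e B i) := by
  obtain ⟨N, M, hN, hM⟩ := hB.bounds
  have he' : (1 : ℤ) ≤ e := by exact_mod_cast he
  refine isBetaSet_of_bounds (N := -|N - i|) (M := |M| + 1) ?_ ?_
  · intro x hx
    refine hN _ ?_
    have h1 := neg_abs_le (N - i)
    have h2 := abs_nonneg (N - i)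
    nlinarith
  · intro x hx
    have h := hM _ hx
    have h1 := le_abs_self M
    have h2 := abs_nonneg M
    by_contra hc
    push Not at hc
    nlinarith

/-- For a beta-set, `enum` is the decreasing enumeration, and `enum B a = charge B - (a + 1)` for
all large `a`. -/
theorem enum_spec {B : Set ℤ} (hB : IsBetaSet B) :
    (∀ a, IsGreatest {x | x ∈ B ∧ ∀ b < a, x < enum B b} (enum B a)) ∧
      ∃ k, ∀ a ≥ k, enum B a = charge B - ((a : ℤ) + 1) := by
  obtain ⟨N₀, M, hN₀, hM⟩ := hB.bounds
  have hgr : ∀ y : ℤ, IsGreatest {x | x ∈ B ∧ x < y} (sSup {x | x ∈ B ∧ x < y}) := fun y => by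
    have hne : {x | x ∈ B ∧ x < y}.Nonempty :=
      ⟨min N₀ y - 1, hN₀ _ (by lia), by lia⟩
    have hbd : BddAbove {x | x ∈ B ∧ x < y} := ⟨y, fun x hx => hx.2.le⟩
    exact ⟨Int.csSup_mem hne hbd, fun x hx => le_csSup hbd hx⟩
  have hgr0 : IsGreatest B (sSup B) := by
    have : B = {x | x ∈ B ∧ x < M} := by
      ext x; exact ⟨fun h => ⟨h, hM x h⟩, fun h => h.1⟩
    rw [this]; exact hgr M
  have hmem : ∀ a, enum B a ∈ B := fun a => by
    cases a with
    | zero => exact hgr0.1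
    | succ a => exact (hgr _).1.1
  have hlt : ∀ a, enum B (a + 1) < enum B a := fun a => (hgr _).1.2
  have hanti : StrictAnti (enum B) := strictAnti_nat_of_succ_lt hlt
  have hG : ∀ a, IsGreatest {x | x ∈ B ∧ ∀ b < a, x < enum B b} (enum B a) := fun a => by
    refine ⟨⟨hmem a, fun b hb => hanti hb⟩, ?_⟩
    rintro x ⟨hx, hxb⟩
    cases a with
    | zero => exact hgr0.2 hx
    | succ a => exact (hgr (enum B a)).2 ⟨hx, hxb a (by lia)⟩
  refine ⟨hG, ?_⟩
  -- the elements above `enum B a` are exactly `enum B b` for `b < a`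
  have habove : ∀ a, B ∩ Set.Ioi (enum B a) = enum B '' Set.Iio a := fun a => by
    ext x
    constructor
    · rintro ⟨hx, hxa⟩
      by_contra hc
      have key : ∀ b, b ≤ a → x < enum B b := fun b => by
        induction b using Nat.strong_induction_on with
        | _ b ih =>
          intro hb
          have hle : x ≤ enum B b := (hG b).2 ⟨hx, fun c hcb => ih c hcb (by lia)⟩
          rcases hle.lt_or_eq with h | h
          · exact h
          · exfalso
            rcases hb.lt_or_eq with h' | h'
            · exact hc ⟨b, h', h.symm⟩
            · subst h'
              exact absurd hxa (by simp [h])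
      exact absurd (key a le_rfl) (not_lt.2 (le_of_lt hxa))
    · rintro ⟨b, hb, rfl⟩
      exact ⟨hmem b, hanti hb⟩
  have hcard : ∀ a, (B ∩ Set.Ioi (enum B a)).ncard = a := fun a => by
    rw [habove, Set.ncard_image_of_injective _ hanti.injective]
    simp [Set.ncard_eq_toFinset_card']
  have hfin : ∀ y : ℤ, (B ∩ Set.Ici y).Finite := fun y =>
    (Set.finite_Ico y M).subset fun x hx => ⟨hx.2, hM x hx.1⟩
  have hfull : ∀ N : ℤ, (∀ x < N, x ∈ B) → ∀ y ≤ N,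
      ((B ∩ Set.Ici y).ncard : ℤ) = (N - y) + (B ∩ Set.Ici N).ncard := fun N hN y hy => by
    have hu : B ∩ Set.Ici y = Set.Ico y N ∪ (B ∩ Set.Ici N) := by
      ext x
      simp only [Set.mem_inter_iff, Set.mem_Ici, Set.mem_union, Set.mem_Ico]
      constructor
      · rintro ⟨h1, h2⟩
        by_cases h : x < N
        · exact Or.inl ⟨h2, h⟩
        · exact Or.inr ⟨h1, by lia⟩
      · rintro (⟨h1, h2⟩ | ⟨h1, h2⟩)
        · exact ⟨hN x h2, h1⟩
        · exact ⟨h1, by lia⟩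
    have hd : Disjoint (Set.Ico y N) (B ∩ Set.Ici N) := by
      rw [Set.disjoint_left]
      rintro x hx ⟨_, h2⟩
      exact absurd hx.2 (not_lt.2 h2)
    rw [hu, Set.ncard_union_eq hd (Set.finite_Ico y N) (hfin N)]
    have : (Set.Ico y N).ncard = (N - y).toNat := by
      simp [Set.ncard_eq_toFinset_card']
    rw [this]
    push_cast
    lia
  set N := min N₀ 0 with hNdef
  have hN : ∀ x < N, x ∈ B := fun x hx => hN₀ x (by lia)
  have hch : charge B = N + (B ∩ Set.Ici N).ncard := by
    have h1 : B ∩ Set.Ici N = (B ∩ Set.Ici 0) ∪ (B ∩ Set.Ico N 0) := by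
      ext x
      simp only [Set.mem_inter_iff, Set.mem_Ici, Set.mem_union, Set.mem_Ico]
      constructor
      · rintro ⟨h1, h2⟩
        by_cases h : 0 ≤ x
        · exact Or.inl ⟨h1, h⟩
        · exact Or.inr ⟨h1, h2, by lia⟩
      · rintro (⟨h1, h2⟩ | ⟨h1, h2, _⟩)
        · exact ⟨h1, by lia⟩
        · exact ⟨h1, h2⟩
    have h2 : Set.Ico N 0 = (B ∩ Set.Ico N 0) ∪ (Set.Iio 0 \ B) := by
      ext x
      simp only [Set.mem_inter_iff, Set.mem_union, Set.mem_Ico, Set.mem_sdiff, Set.mem_Iio]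
      constructor
      · rintro ⟨h1, h2⟩
        by_cases h : x ∈ B
        · exact Or.inl ⟨h, h1, h2⟩
        · exact Or.inr ⟨h2, h⟩
      · rintro (⟨h1, h2⟩ | ⟨h1, h2⟩)
        · exact h2
        · refine ⟨?_, h1⟩
          by_contra h
          exact h2 (hN x (by lia))
    have hf1 : (B ∩ Set.Ico N 0).Finite := (Set.finite_Ico N 0).subset Set.inter_subset_right
    have hf2 : (Set.Iio 0 \ B).Finite := by
      refine (Set.finite_Ico N 0).subset ?_
      rw [h2]; exact Set.subset_union_right
    have c1 := congrArg Set.ncard h1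
    rw [Set.ncard_union_eq (by
      rw [Set.disjoint_left]
      rintro x ⟨_, h⟩ ⟨_, _, h'⟩
      exact absurd h' (not_lt.2 h)) (hfin 0) hf1] at c1
    have c2 := congrArg Set.ncard h2
    rw [Set.ncard_union_eq (by
      rw [Set.disjoint_left]
      rintro x ⟨h, _⟩ ⟨_, h'⟩
      exact h' h) hf1 hf2] at c2
    have c3 : (Set.Ico N 0).ncard = (0 - N).toNat := by
      simp [Set.ncard_eq_toFinset_card']
    have hN0 : N ≤ 0 := min_le_right _ _
    unfold charge
    lia
  refine ⟨(B ∩ Set.Ici N).ncard, fun a ha => ?_⟩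
  have hIoi : B ∩ Set.Ioi (enum B a) = B ∩ Set.Ici (enum B a + 1) := by
    ext x
    simp
  have haN : enum B a < N := by
    by_contra hc
    push Not at hc
    have hss : B ∩ Set.Ioi (enum B a) ⊂ B ∩ Set.Ici N := by
      refine ⟨fun x hx => ⟨hx.1, le_trans hc (le_of_lt hx.2)⟩, fun h => ?_⟩
      have := h ⟨hmem a, hc⟩
      exact absurd this.2 (by simp)
    have := Set.ncard_lt_ncard hss (hfin N)
    rw [hcard] at this
    lia
  have h1 := hfull N hN (enum B a + 1) (by lia)
  rw [← hIoi, hcard] at h1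
  lia

theorem finite_support_weight {e : ℕ} (he : 0 < e) {B : Set ℤ} (hB : IsBetaSet B) (i : ℕ) :
    (Function.support fun a : ℕ =>
      enum (quot e B i) a - charge (quot e B i) + ((a : ℤ) + 1)).Finite := by
  obtain ⟨k, hk⟩ := (enum_spec (isBetaSet_quot he hB i)).2
  refine (Set.finite_Iio k).subset fun a ha => ?_
  by_contra h
  simp only [Set.mem_Iio, not_lt] at h
  exact ha (by simp [hk a h])

/-- Every beta-set is the beta-set of a unique partition, with charge that of the beta-set. -/
theorem existsUnique_beta {B : Set ℤ} (hB : IsBetaSet B) :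
    ∃! lam : YoungDiagram, beta (charge B) lam = B := by
  obtain ⟨hG, k, hk⟩ := enum_spec hB
  have hmem : ∀ a, enum B a ∈ B := fun a => (hG a).1.1
  have hlt : ∀ a, enum B (a + 1) < enum B a := fun a => (hG (a + 1)).1.2 a (by lia)
  have hge : ∀ a, 0 ≤ enum B a - charge B + ((a : ℤ) + 1) := by
    have hanti : Antitone fun a : ℕ => enum B a - charge B + ((a : ℤ) + 1) :=
      antitone_nat_of_succ_le fun a => by
        have := hlt a
        push_cast
        lia
    intro a
    have h1 := hanti (le_max_left a k)
    have h2 := hk (max a k) (le_max_right a k)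
    simp only at h1
    lia
  have hsurj : ∀ x ∈ B, ∃ a, enum B a = x := fun x hx => by
    by_contra hc
    push Not at hc
    have key : ∀ a, x < enum B a := fun a => by
      induction a using Nat.strong_induction_on with
      | _ a ih => exact lt_of_le_of_ne ((hG a).2 ⟨hx, ih⟩) (hc a).symm
    have h := key (max k (charge B - x).toNat)
    rw [hk _ (le_max_left _ _)] at h
    have := le_max_right k (charge B - x).toNat
    lia
  let f : ℕ → ℕ := fun a => (enum B a - charge B + ((a : ℤ) + 1)).toNat
  have hf : Antitone f := antitone_nat_of_succ_le fun a => by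
    have := hlt a
    simp only [f]
    push_cast
    lia
  have hf0 : ∀ a ≥ k, f a = 0 := fun a ha => by
    simp [f, hk a ha]
  let D : YoungDiagram :=
    { cells := (Finset.range k ×ˢ Finset.range (f 0)).filter fun c => c.2 < f c.1
      isLowerSet := by
        rintro ⟨a, b⟩ ⟨a', b'⟩ ⟨h1, h2⟩ h
        simp only [Finset.coe_filter, Finset.mem_product, Finset.mem_range,
          Set.mem_ofPred_eq] at h ⊢
        simp only at h1 h2
        have := hf h1
        exact ⟨⟨by lia, by lia⟩, by lia⟩ }
  have hD : ∀ a b, (a, b) ∈ D ↔ b < f a := fun a b => by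
    rw [← YoungDiagram.mem_cells]
    simp only [D, Finset.mem_filter, Finset.mem_product, Finset.mem_range]
    refine ⟨fun h => h.2, fun h => ⟨⟨?_, lt_of_lt_of_le h (hf (Nat.zero_le a))⟩, h⟩⟩
    by_contra hc
    rw [hf0 a (by lia)] at h
    lia
  have hrow : ∀ a, D.rowLen a = f a := fun a => by
    apply le_antisymm
    · by_contra hc
      push Not at hc
      exact lt_irrefl _ ((hD a (f a)).1 (YoungDiagram.mem_iff_lt_rowLen.2 hc))
    · by_contra hc
      push Not at hc
      exact lt_irrefl _ (YoungDiagram.mem_iff_lt_rowLen.1 ((hD a (D.rowLen a)).2 hc))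
  have hval : ∀ a : ℕ, (D.rowLen a : ℤ) + charge B - ((a : ℤ) + 1) = enum B a := fun a => by
    have := hge a
    rw [hrow]
    simp only [f]
    lia
  have hDB : beta (charge B) D = B := by
    ext x
    simp only [beta, hval, Set.mem_range]
    exact ⟨fun ⟨a, h⟩ => h ▸ hmem a, hsurj x⟩
  refine ⟨D, hDB, fun E hE => ?_⟩
  have hs : ∀ F : YoungDiagram,
      StrictMono fun a : ℕ => -((F.rowLen a : ℤ) + charge B - ((a : ℤ) + 1)) := fun F =>
    strictMono_nat_of_lt_succ fun a => by
      have := F.rowLen_anti a (a + 1) (by lia)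
      push_cast
      lia
  have hr : (fun a : ℕ => -((E.rowLen a : ℤ) + charge B - ((a : ℤ) + 1))) =
      fun a : ℕ => -((D.rowLen a : ℤ) + charge B - ((a : ℤ) + 1)) := by
    rw [← (hs E).range_inj (hs D)]
    have h := congrArg (fun S : Set ℤ => Neg.neg '' S) (hE.trans hDB.symm)
    simp only [beta, ← Set.range_comp] at h
    exact h
  have hrl : ∀ a, E.rowLen a = D.rowLen a := fun a => by
    have := congrFun hr a
    lia
  apply YoungDiagram.ext
  ext ⟨a, b⟩
  rw [YoungDiagram.mem_cells, YoungDiagram.mem_cells, YoungDiagram.mem_iff_lt_rowLen,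
    YoungDiagram.mem_iff_lt_rowLen, hrl]

/-- The unique partition whose beta-set of charge `charge B` is the beta-set `B`. -/
def betaInv (B : Set ℤ) : YoungDiagram :=
  Classical.epsilon fun lam : YoungDiagram => beta (charge B) lam = B

theorem beta_betaInv {B : Set ℤ} (hB : IsBetaSet B) : beta (charge B) (betaInv B) = B :=
  Classical.epsilon_spec (existsUnique_beta hB).exists

/-! ### Uglov's map -/

/-- `x = a e + b` with `0 ≤ b < e` is sent to `a e ℓ + (ℓ - j) e + b`; the component number `j`
of the usual convention is `(j : ℕ) + 1` here. -/
def upsilon (e ℓ : ℕ) (j : Fin ℓ) (x : ℤ) : ℤ :=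
  (x - x % (e : ℤ)) * (ℓ : ℤ) + ((ℓ : ℤ) - ((j : ℤ) + 1)) * (e : ℤ) + x % (e : ℤ)

/-- Uglov's map from `ℓ`-tuples of beta-sets to beta-sets. -/
def uglov (e : ℕ) {ℓ : ℕ} (B : Fin ℓ → Set ℤ) : Set ℤ :=
  ⋃ j : Fin ℓ, upsilon e ℓ j '' B j

theorem isBetaSet_uglov {e ℓ : ℕ} (he : 0 < e) (hl : 0 < ℓ) {B : Fin ℓ → Set ℤ}
    (hB : ∀ j, IsBetaSet (B j)) : IsBetaSet (uglov e B) := by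
  have he' : (1 : ℤ) ≤ e := by exact_mod_cast he
  have hl' : (1 : ℤ) ≤ ℓ := by exact_mod_cast hl
  choose N M hN hM using fun j => (hB j).bounds
  have hup : ∀ (j : Fin ℓ) (x : ℤ),
      upsilon e ℓ j x = (x / e * ℓ + (ℓ - (j + 1))) * e + x % e := fun j x => by
    have := Int.mul_ediv_add_emod x e
    have h2 : x - x % e = e * (x / e) := by lia
    unfold upsilon
    rw [h2]
    ring
  -- common bounds
  let N' : ℤ := -∑ j, |N j|
  let M' : ℤ := ∑ j, |M j|
  have hN' : ∀ j, N' ≤ N j := fun j => by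
    have h1 := Finset.single_le_sum (f := fun j => |N j|) (fun i _ => abs_nonneg _)
      (Finset.mem_univ j)
    have h2 := neg_abs_le (N j)
    simp only [N'] at *
    lia
  have hM' : ∀ j, M j ≤ M' := fun j => by
    have h1 := Finset.single_le_sum (f := fun j => |M j|) (fun i _ => abs_nonneg _)
      (Finset.mem_univ j)
    have h2 := le_abs_self (M j)
    simp only [M'] at *
    lia
  have hN0 : N' ≤ 0 := neg_nonpos.2 (Finset.sum_nonneg fun j _ => abs_nonneg _)
  have hM0 : 0 ≤ M' := Finset.sum_nonneg fun j _ => abs_nonneg _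
  refine isBetaSet_of_bounds (N := N' * e * ℓ) (M := (M' * ℓ + ℓ) * e) ?_ ?_
  · intro y hy
    have hb0 := Int.emod_nonneg y (b := (e : ℤ)) (by lia)
    have hb1 := Int.emod_lt_of_pos y (b := (e : ℤ)) (by lia)
    have hc0 := Int.emod_nonneg (y / e) (b := (ℓ : ℤ)) (by lia)
    have hc1 := Int.emod_lt_of_pos (y / e) (b := (ℓ : ℤ)) (by lia)
    have hy1 := Int.mul_ediv_add_emod y e
    have hy2 := Int.mul_ediv_add_emod (y / e) ℓ
    have hj : (ℓ - 1 - (y / e % ℓ).toNat) < ℓ := by lia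
    let j : Fin ℓ := ⟨ℓ - 1 - (y / e % ℓ).toNat, hj⟩
    have hjv : ((j : ℕ) : ℤ) = ℓ - 1 - y / e % ℓ := by
      simp only [j]
      lia
    refine Set.mem_iUnion.2 ⟨j, y / e / ℓ * e + y % e, ?_, ?_⟩
    · apply hN
      refine lt_of_lt_of_le ?_ (hN' j)
      have hq : y / e < N' * ℓ := by
        apply Int.ediv_lt_of_lt_mul (by lia)
        calc y < N' * e * ℓ := hy
          _ = N' * ℓ * e := by ring
      have hq2 : y / e / ℓ < N' := Int.ediv_lt_of_lt_mul (by lia) hq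
      nlinarith
    · have hd : (y / e / ℓ * e + y % e) / (e : ℤ) = y / e / ℓ := by
        rw [add_comm, Int.add_mul_ediv_right _ _ (by lia), Int.ediv_eq_zero_of_lt hb0 hb1]
        lia
      have hm : (y / e / ℓ * e + y % e) % (e : ℤ) = y % e := by
        rw [add_comm, Int.add_mul_emod_self_right, Int.emod_emod]
      rw [hup, hd, hm, hjv]
      linear_combination hy1 + e * hy2
  · intro y hy
    obtain ⟨j, x, hx, rfl⟩ := Set.mem_iUnion.1 hy
    rw [hup]
    have hb1 := Int.emod_lt_of_pos x (b := (e : ℤ)) (by lia)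
    have hxM : x < M' := lt_of_lt_of_le (hM j x hx) (hM' j)
    have hq : x / e ≤ M' := by
      apply Int.ediv_le_of_le_mul (by lia)
      nlinarith
    have h1 : x / e * ℓ + (ℓ - (j + 1)) ≤ M' * ℓ + ℓ - 1 := by
      have : (0 : ℤ) ≤ (j : ℕ) := by lia
      nlinarith
    nlinarith

theorem isBetaSet_coreSet {e : ℕ} (he : 0 < e) (B : Set ℤ) : IsBetaSet (coreSet e B) := by
  have he' : (1 : ℤ) ≤ e := by exact_mod_cast he
  let S : ℤ := ∑ i ∈ Finset.range e, |charge (quot e B i)|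
  have hS : ∀ i < e, |charge (quot e B i)| ≤ S := fun i hi =>
    Finset.single_le_sum (f := fun i => |charge (quot e B i)|) (fun i _ => abs_nonneg _)
      (Finset.mem_range.2 hi)
  refine isBetaSet_of_bounds (N := -S * e) (M := S * e) ?_ ?_
  · intro x hx
    have hb0 := Int.emod_nonneg x (b := (e : ℤ)) (by lia)
    have hb1 := Int.emod_lt_of_pos x (b := (e : ℤ)) (by lia)
    have hx1 := Int.mul_ediv_add_emod x e
    have hq : x / e < -S := Int.ediv_lt_of_lt_mul (by lia) hx
    refine ⟨(x % e).toNat, by lia, x / e, ?_, ?_⟩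
    · have h1 := hS (x % e).toNat (by lia)
      have h2 := neg_abs_le (charge (quot e B (x % e).toNat))
      lia
    · rw [Int.toNat_of_nonneg hb0]
      linear_combination -hx1
  · rintro x ⟨i, hi, a, ha, rfl⟩
    have h1 := hS i hi
    have h2 := le_abs_self (charge (quot e B i))
    have h3 : a + 1 ≤ S := by lia
    nlinarith

/-! ### Multipartitions -/

/-- The Young diagram of an `ℓ`-partition, as a finite set of nodes: `⟨j, (a, b)⟩` is the node in
row `a` and column `b` of component `j`. -/
def nodes {ℓ : ℕ} (lam : Fin ℓ → YoungDiagram) : Finset (Σ _ : Fin ℓ, ℕ × ℕ) :=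
  Finset.univ.sigma fun j => (lam j).cells

/-- The `e`-residue of a node relative to `t`. -/
def nodeRes (e : ℕ) {ℓ : ℕ} (t : Fin ℓ → ℤ) (c : Σ _ : Fin ℓ, ℕ × ℕ) : ZMod e :=
  (((c.2.2 : ℤ) - (c.2.1 : ℤ) + t c.1 : ℤ) : ZMod e)

/-- The multiset of `e`-residues of an `ℓ`-partition relative to `t`. -/
def res (e : ℕ) {ℓ : ℕ} (t : Fin ℓ → ℤ) (lam : Fin ℓ → YoungDiagram) : Multiset (ZMod e) :=
  (nodes lam).val.map (nodeRes e t)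

/-- The image under Uglov's map of the tuple of beta-sets of `lam` with charges `t`. -/
def uglovBeta (e : ℕ) {ℓ : ℕ} (x : (Fin ℓ → YoungDiagram) × (Fin ℓ → ℤ)) : Set ℤ :=
  uglov e fun j => beta (x.2 j) (x.1 j)

/-- The `e`-core of an `ℓ`-partition with an `ℓ`-charge. -/
def core (e : ℕ) {ℓ : ℕ} (x : (Fin ℓ → YoungDiagram) × (Fin ℓ → ℤ)) : YoungDiagram :=
  betaInv (coreSet e (uglovBeta e x))

/-- The `e`-weight of an `ℓ`-partition with an `ℓ`-charge. -/
def wt (e : ℕ) {ℓ : ℕ} (x : (Fin ℓ → YoungDiagram) × (Fin ℓ → ℤ)) : ℤ :=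
  wtSet e (uglovBeta e x)

/-! ### The extended affine Weyl group -/

/-- The extended affine Weyl group `ℤ^ℓ ⋊ 𝔖_ℓ`, where `σ u σ⁻¹ = u ∘ σ⁻¹`, that is,
`σ⁻¹ u σ = u ∘ σ` is the right place permutation action. -/
abbrev ExtAffineWeyl (ℓ : ℕ) : Type :=
  (Fin ℓ → Multiplicative ℤ) ⋊[mulAutArrow] Equiv.Perm (Fin ℓ)

/-- The right action of the extended affine Weyl group on pairs of an `ℓ`-partition and an
`ℓ`-charge.  An element of the semidirect product is the product `w.left * w.right`, so the
translation acts first; see `act_perm_mul_translation` for the action of `σ u`. -/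
def act (e : ℕ) {ℓ : ℕ} (x : (Fin ℓ → YoungDiagram) × (Fin ℓ → ℤ)) (w : ExtAffineWeyl ℓ) :
    (Fin ℓ → YoungDiagram) × (Fin ℓ → ℤ) :=
  (fun j => x.1 (w.right j),
    fun j => x.2 (w.right j) + (e : ℤ) * Multiplicative.toAdd (w.left (w.right j)))

theorem act_one (e : ℕ) {ℓ : ℕ} (x : (Fin ℓ → YoungDiagram) × (Fin ℓ → ℤ)) :
    act e x 1 = x := by
  simp [act]

theorem act_mul (e : ℕ) {ℓ : ℕ} (x : (Fin ℓ → YoungDiagram) × (Fin ℓ → ℤ))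
    (v w : ExtAffineWeyl ℓ) : act e x (v * w) = act e (act e x v) w := by
  refine Prod.ext ?_ ?_
  · funext j
    simp [act]
  · funext j
    have h : (mulAutArrow v.right w.left) (v.right (w.right j)) = w.left (w.right j) :=
      congrArg w.left (v.right.symm_apply_apply _)
    simp only [act, SemidirectProduct.mul_left, SemidirectProduct.mul_right, Pi.mul_apply,
      Equiv.Perm.mul_apply, toAdd_mul, h]
    ring

/-- `(lam; t)^{σ u} = (lam^σ; t^σ + e u)`. -/
theorem act_perm_mul_translation (e : ℕ) {ℓ : ℕ} (lam : Fin ℓ → YoungDiagram) (t : Fin ℓ → ℤ)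
    (σ : Equiv.Perm (Fin ℓ)) (u : Fin ℓ → ℤ) :
    act e (lam, t) (SemidirectProduct.inr σ *
        SemidirectProduct.inl (fun j => Multiplicative.ofAdd (u j))) =
      (fun j => lam (σ j), fun j => t (σ j) + (e : ℤ) * u j) := by
  rw [act_mul]
  simp [act]

/-- The orbit of a pair under the extended affine Weyl group. -/
def orbit (e : ℕ) {ℓ : ℕ} (x : (Fin ℓ → YoungDiagram) × (Fin ℓ → ℤ)) :
    Set ((Fin ℓ → YoungDiagram) × (Fin ℓ → ℤ)) :=
  Set.range (act e x)

end

end Uglov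

namespace Uglov

/-! Write `c_i` for the number of nodes of residue `i`. Sums over a beta-set are regularized by
subtracting the sum over the negative integers. By `signedSum_beta`, each node of shifted content
`y` then contributes `f y - f (y - 1)`: it moves a bead from `y - 1` to `y`.

Uglov's map places the `e`-quotients of the components on interleaved runners (`quot_quot_uglov`),
so regularized sums over its image become sums over the components. For the indicator of a residue
class this gives the charge of runner `i` as a constant depending on `t` plus `c_i - c_{i+1}`
(`charge_quot_uglovBeta`). With `t` fixed, the core therefore determines exactly the differences
`c_i - c_{i+1}` (`core_eq_iff`). For the position function, only a node of residue `0` crosses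
between blocks of length `e`, and it raises the total by `ℓ`. So the weight is a constant depending
on `t`, plus `ℓ * c_0`, minus a function of the core's runner charges (`wt_eq`).

If the cores agree, the weights differ by `ℓ * (c_0(lam) - c_0(mu))`. The group preserves all
residue counts and changes both charges identically, so this difference is the same at every group
element and is also the difference of the two minima (`isLeast_wt_orbit_add`). Equal minima thus
mean equal `c_0`, and the core differences then give every other `c_i`. -/

/-! ### Regularized sums over beta-sets -/

/-- The difference of the indicator functions of `B` and of the negative integers. -/
noncomputable def signedIndicator (B : Set ℤ) (x : ℤ) : ℤ :=
  B.indicator 1 x - (Set.Iio 0).indicator 1 x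

/-- The sum of `f` over `B`, regularized by subtracting the sum over the negative integers. -/
noncomputable def signedSum (B : Set ℤ) (f : ℤ → ℤ) : ℤ :=
  ∑ᶠ x, signedIndicator B x * f x

theorem signedIndicator_congr {B C : Set ℤ} {x y : ℤ} (h : x ∈ B ↔ y ∈ C) (h0 : x < 0 ↔ y < 0) :
    signedIndicator B x = signedIndicator C y := by
  classical
  simp [signedIndicator, Set.indicator_apply, h, h0]

theorem IsBetaSet.finite_support_signedIndicator {B : Set ℤ} (hB : IsBetaSet B) :
    (Function.support (signedIndicator B)).Finite := by
  obtain ⟨N, M, hN, hM⟩ := hB.bounds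
  refine (Set.finite_Ico (min N 0) (max M 0)).subset fun x hx => ?_
  by_contra h
  apply hx
  simp only [Set.mem_Ico, not_and_or, not_le, not_lt] at h
  rcases h with h | h
  · have h1 : x ∈ B := hN x (by lia)
    have h2 : x < 0 := by lia
    simp [signedIndicator, h1, h2]
  · have h1 : x ∉ B := fun h' => by have := hM x h'; lia
    have h2 : ¬ x < 0 := by lia
    simp [signedIndicator, h1, h2]

theorem IsBetaSet.finite_support_signedIndicator_mul {B : Set ℤ} (hB : IsBetaSet B) (f : ℤ → ℤ) :
    (Function.support fun x => signedIndicator B x * f x).Finite :=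
  hB.finite_support_signedIndicator.subset fun x hx h => hx (by simp [h])

theorem isBetaSet_Iio (c : ℤ) : IsBetaSet (Set.Iio c) :=
  isBetaSet_of_bounds (N := c) (M := c) (fun _ h => h) (fun _ h => h)

theorem charge_eq_signedSum {B : Set ℤ} (hB : IsBetaSet B) : charge B = signedSum B 1 := by
  obtain ⟨N, M, hN, hM⟩ := hB.bounds
  have hf1 : (B ∩ Set.Ici 0).Finite :=
    (Set.finite_Ico 0 M).subset fun x hx => ⟨hx.2, hM x hx.1⟩
  have hf2 : (Set.Iio 0 \ B).Finite :=
    (Set.finite_Ico N 0).subset fun x hx => ⟨not_lt.1 fun h => hx.2 (hN x h), hx.1⟩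
  have key : ∀ x, signedIndicator B x * (1 : ℤ → ℤ) x =
      (B ∩ Set.Ici 0).indicator 1 x - (Set.Iio 0 \ B).indicator 1 x := fun x => by
    by_cases h1 : x ∈ B <;> by_cases h2 : x < 0 <;>
      simp [signedIndicator, h1, h2, Set.indicator]
  have hcard : ∀ s : Set ℤ, s.Finite → ∑ᶠ x, s.indicator (1 : ℤ → ℤ) x = s.ncard := fun s hs => by
    rw [finsum_eq_sum_of_support_subset (s := hs.toFinset) _ (by
      intro x hx
      simpa using Set.mem_of_indicator_ne_zero hx)]
    rw [Set.ncard_eq_toFinset_card s hs, Finset.card_eq_sum_ones, Nat.cast_sum]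
    refine Finset.sum_congr rfl fun x hx => ?_
    simp [(hs.mem_toFinset).1 hx]
  rw [signedSum, finsum_congr key, finsum_sub_distrib, hcard _ hf1, hcard _ hf2, charge]
  · exact hf1.subset Set.support_indicator_subset
  · exact hf2.subset Set.support_indicator_subset

theorem charge_Iio (c : ℤ) : charge (Set.Iio c) = c := by
  have h1 : Set.Iio c ∩ Set.Ici 0 = Set.Ico 0 c := by
    ext x; simp [and_comm]
  have h2 : Set.Iio 0 \ Set.Iio c = Set.Ico c 0 := by
    ext x; simp
  rw [charge, h1, h2]
  simp only [Set.ncard_eq_toFinset_card', Set.toFinset_Ico, Int.card_Ico]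
  lia

/-! ### Signed sums over enumerated sets -/

/-- From index `k` on, the values of `b` fill exactly the half-line below `c - k`, so only the first
`k` values need separate treatment. -/
theorem signedSum_range {b : ℕ → ℤ} (hb : Function.Injective b) {c : ℤ} {k : ℕ}
    (hk : ∀ a ≥ k, b a = c - ((a : ℤ) + 1)) (f : ℤ → ℤ) :
    signedSum (Set.range b) f =
      ∑ a ∈ Finset.range k, f (b a) + signedSum (Set.Iio (c - k)) f := by
  classical
  have hlow : ∀ x, x < c - k ↔ ∃ a ≥ k, b a = x := fun x => by
    constructor
    · intro h
      exact ⟨(c - x - 1).toNat, by lia, by rw [hk _ (by lia)]; lia⟩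
    · rintro ⟨a, ha, rfl⟩
      rw [hk a ha]
      lia
  let T : Finset ℤ := (Finset.range k).image b
  have hmem : ∀ x, x ∈ Set.range b ↔ x ∈ T ∨ x < c - k := fun x => by
    simp only [T, hlow, Set.mem_range, Finset.mem_image, Finset.mem_range]
    constructor
    · rintro ⟨a, rfl⟩
      rcases lt_or_ge a k with h | h
      · exact Or.inl ⟨a, h, rfl⟩
      · exact Or.inr ⟨a, h, rfl⟩
    · rintro (⟨a, -, h⟩ | ⟨a, -, h⟩) <;> exact ⟨a, h⟩
  have hdisj : ∀ x ∈ T, ¬ x < c - k := fun x hx h => by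
    obtain ⟨a, ha, rfl⟩ := Finset.mem_image.1 hx
    obtain ⟨a', ha', h'⟩ := (hlow _).1 h
    have := hb h'
    have := Finset.mem_range.1 ha
    lia
  have key : ∀ x, signedIndicator (Set.range b) x * f x =
      (if x ∈ T then f x else 0) + signedIndicator (Set.Iio (c - k)) x * f x := fun x => by
    by_cases h1 : x ∈ T
    · have h2 := hdisj x h1
      have h3 := (hmem x).2 (Or.inl h1)
      simp only [signedIndicator, Set.indicator_of_mem h3, h1, if_true,
        Set.indicator_of_notMem (show x ∉ Set.Iio (c - k) from h2), Pi.one_apply]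
      ring
    · have h3 : x ∈ Set.range b ↔ x ∈ Set.Iio (c - k) := by
        rw [hmem]; simp [h1]
      rw [signedIndicator_congr h3 Iff.rfl, if_neg h1, zero_add]
  have hsub : (Function.support fun x => if x ∈ T then f x else 0) ⊆ T := fun x hx => by
    by_contra h
    exact hx (if_neg h)
  rw [signedSum, finsum_congr key, finsum_add_distrib (T.finite_toSet.subset hsub)
    ((isBetaSet_Iio _).finite_support_signedIndicator_mul f), signedSum,
    finsum_eq_sum_of_support_subset _ hsub]
  congr 1
  rw [Finset.sum_congr rfl fun x hx => if_pos hx, Finset.sum_image hb.injOn]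

/-- Applying `signedSum_range` also to the ground configuration `c - 1, c - 2, …` with the same `k`
cancels the common tail; beads are compared one by one. -/
theorem signedSum_range_sub {b : ℕ → ℤ} (hb : Function.Injective b) {c : ℤ} {k : ℕ}
    (hk : ∀ a ≥ k, b a = c - ((a : ℤ) + 1)) (f : ℤ → ℤ) :
    signedSum (Set.range b) f = signedSum (Set.Iio c) f +
      ∑ a ∈ Finset.range k, (f (b a) - f (c - ((a : ℤ) + 1))) := by
  have hrange : Set.Iio c = Set.range fun a : ℕ => c - ((a : ℤ) + 1) := by
    ext x
    constructor
    · intro h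
      have h : x < c := h
      exact ⟨(c - x - 1).toNat, by simp only; lia⟩
    · rintro ⟨a, rfl⟩
      show _ < c
      lia
  have h2 := signedSum_range (b := fun a : ℕ => c - ((a : ℤ) + 1)) (c := c) (k := k)
    (fun a a' h => by simp only at h; lia) (fun a _ => rfl) f
  rw [signedSum_range hb hk f, hrange, h2, Finset.sum_sub_distrib]
  ring

/-- Row `a` moves its bead from `t - a - 1` to the right by the row length; the change in `f`
telescopes into one unit step per node of the row. -/
theorem signedSum_beta (t : ℤ) (lam : YoungDiagram) (f : ℤ → ℤ) :
    signedSum (beta t lam) f = signedSum (Set.Iio t) f +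
      ∑ c ∈ lam.cells, (f ((c.2 : ℤ) - c.1 + t) - f ((c.2 : ℤ) - c.1 + t - 1)) := by
  have h0 : ∀ a ≥ lam.colLen 0, lam.rowLen a = 0 := fun a ha => by
    by_contra h
    have : (a, 0) ∈ lam := YoungDiagram.mem_iff_lt_rowLen.2 (by lia)
    have := YoungDiagram.mem_iff_lt_colLen.1 this
    lia
  have hanti : StrictAnti fun a : ℕ => (lam.rowLen a : ℤ) + t - ((a : ℤ) + 1) :=
    strictAnti_nat_of_succ_lt fun a => by
      have := lam.rowLen_anti a (a + 1) (by lia)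
      push_cast
      lia
  rw [beta, signedSum_range_sub hanti.injective (c := t) (k := lam.colLen 0)
    (fun a ha => by simp only [h0 a ha]; lia)]
  congr 1
  rw [Finset.sum_finset_product lam.cells (Finset.range (lam.colLen 0))
    (fun a => Finset.range (lam.rowLen a))]
  · refine Finset.sum_congr rfl fun a _ => ?_
    have := Finset.sum_range_sub (fun b : ℕ => f ((b : ℤ) - a + t - 1)) (lam.rowLen a)
    convert this.symm using 2
    · congr 1
      ring
    · congr 1
      push_cast
      ring
    · congr 2
      push_cast
      ring
  · rintro ⟨a, b⟩
    simp only [YoungDiagram.mem_cells, Finset.mem_range, ← YoungDiagram.mem_iff_lt_rowLen,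
      ← YoungDiagram.mem_iff_lt_colLen]
    exact ⟨fun h => ⟨lam.up_left_mem le_rfl (Nat.zero_le _) h, h⟩, fun h => h.2⟩

/-! ### Weights as regularized sums -/

theorem strictAnti_enum {B : Set ℤ} (hB : IsBetaSet B) : StrictAnti (enum B) :=
  strictAnti_nat_of_succ_lt fun a => ((enum_spec hB).1 (a + 1)).1.2 a (by lia)

theorem range_enum {B : Set ℤ} (hB : IsBetaSet B) : Set.range (enum B) = B := by
  obtain ⟨hG, k, hk⟩ := enum_spec hB
  refine Set.Subset.antisymm (Set.range_subset_iff.2 fun a => (hG a).1.1) fun x hx => ?_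
  by_contra hc
  -- An element missed by the enumeration would lie below all of its values, but these tend to minus
  -- infinity.
  have key : ∀ a, x < enum B a := fun a => by
    induction a using Nat.strong_induction_on with
    | _ a ih => exact lt_of_le_of_ne ((hG a).2 ⟨hx, ih⟩) fun h => hc ⟨a, h.symm⟩
  have h := key (max k (charge B - x).toNat)
  rw [hk _ (le_max_left _ _)] at h
  have := le_max_right k (charge B - x).toNat
  lia

theorem enum_sub_charge_nonneg {B : Set ℤ} (hB : IsBetaSet B) (a : ℕ) :
    0 ≤ enum B a - charge B + ((a : ℤ) + 1) := by
  obtain ⟨k, hk⟩ := (enum_spec hB).2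
  have hanti : Antitone fun a : ℕ => enum B a - charge B + ((a : ℤ) + 1) :=
    antitone_nat_of_succ_le fun a => by
      have := strictAnti_enum hB (Nat.lt_succ_self a)
      push_cast
      lia
  have h1 := hanti (le_max_left a k)
  have h2 := hk (max a k) (le_max_right a k)
  simp only at h1
  lia

theorem finsum_enum_sub_charge {B : Set ℤ} (hB : IsBetaSet B) :
    ∑ᶠ a : ℕ, (enum B a - charge B + ((a : ℤ) + 1)) =
      signedSum B id - signedSum (Set.Iio (charge B)) id := by
  obtain ⟨k, hk⟩ := (enum_spec hB).2
  have h := signedSum_range_sub (strictAnti_enum hB).injective hk id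
  rw [range_enum hB] at h
  rw [h, add_sub_cancel_left, finsum_eq_sum_of_support_subset (s := Finset.range k)]
  · exact Finset.sum_congr rfl fun a _ => by simp only [id]; ring
  · intro a ha
    by_contra hc
    simp only [Finset.coe_range, Set.mem_Iio, not_lt] at hc
    exact ha (by simp [hk a hc])

/-- This separates a part additive in the beads from a part that depends only on the runner charges,
hence only on the core. -/
theorem wtSet_eq {e : ℕ} (he : 0 < e) {B : Set ℤ} (hB : IsBetaSet B) :
    wtSet e B = ∑ i ∈ Finset.range e, signedSum (quot e B i) id -
      ∑ i ∈ Finset.range e, signedSum (Set.Iio (charge (quot e B i))) id := by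
  rw [wtSet, ← Finset.sum_sub_distrib]
  exact Finset.sum_congr rfl fun i _ => finsum_enum_sub_charge (isBetaSet_quot he hB i)

theorem wtSet_nonneg {e : ℕ} (he : 0 < e) {B : Set ℤ} (hB : IsBetaSet B) : 0 ≤ wtSet e B :=
  Finset.sum_nonneg fun i _ =>
    finsum_nonneg fun a => enum_sub_charge_nonneg (isBetaSet_quot he hB i) a

/-! ### Signed sums and quotients -/

/-- Since `0 ≤ i < e`, a position and its label on the runner have the same sign, so the
regularizations are compatible. -/
theorem signedIndicator_quot {e i : ℕ} (hi : i < e) (B : Set ℤ) (a : ℤ) :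
    signedIndicator (quot e B i) a = signedIndicator B (a * e + i) := by
  refine signedIndicator_congr Iff.rfl ⟨fun h => by nlinarith, fun h => ?_⟩
  by_contra hc
  push Not at hc
  have : 0 ≤ a * (e : ℤ) := mul_nonneg hc (by lia)
  lia

theorem signedSum_eq_sum_quot {e : ℕ} (he : 0 < e) {B : Set ℤ} (hB : IsBetaSet B) (f : ℤ → ℤ) :
    signedSum B f =
      ∑ i ∈ Finset.range e, signedSum (quot e B i) fun a => f (a * e + i) := by
  have he' : (0 : ℤ) < e := by exact_mod_cast he
  have key : ∀ x, signedIndicator B x * f x = ∑ i ∈ Finset.range e,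
      if x % e = i then signedIndicator B x * f x else 0 := fun x => by
    have h0 := Int.emod_nonneg x he'.ne'
    have h1 := Int.emod_lt_of_pos x he'
    rw [Finset.sum_eq_single_of_mem (x % e).toNat (Finset.mem_range.2 (by lia))
      fun i _ hi => if_neg (by lia), if_pos (by lia)]
  classical
  rw [signedSum, finsum_congr key, finsum_sum_comm]
  · refine Finset.sum_congr rfl fun i hi => ?_
    have hi := Finset.mem_range.1 hi
    have hinj : Function.Injective fun a : ℤ => a * (e : ℤ) + i := fun a a' h => by
      simpa [he.ne'] using h
    have hmem : ∀ x : ℤ, x ∈ (Set.range fun a : ℤ => a * (e : ℤ) + i) ↔ x % e = i := fun x => by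
      constructor
      · rintro ⟨a, rfl⟩
        simp only
        rw [add_comm, Int.add_mul_emod_self_right, Int.emod_eq_of_lt (by lia) (by lia)]
      · intro h
        refine ⟨x / e, ?_⟩
        simp only
        rw [← h, mul_comm, Int.mul_ediv_add_emod]
    rw [signedSum]
    simp only [signedIndicator_quot hi]
    rw [← finsum_mem_range (f := fun x => signedIndicator B x * f x) hinj]
    refine finsum_congr fun x => ?_
    by_cases h : x % e = i
    · rw [if_pos h, finsum_eq_if, if_pos ((hmem x).2 h)]
    · rw [if_neg h, finsum_eq_if, if_neg (mt (hmem x).1 h)]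
  · intro i _
    refine (hB.finite_support_signedIndicator_mul f).subset fun x hx h => hx ?_
    simp only at h
    simp [h]

theorem charge_quot {e i : ℕ} (hi : i < e) {B : Set ℤ} (hB : IsBetaSet B) :
    charge (quot e B i) = signedSum B fun x => if x % e = i then 1 else 0 := by
  have he : 0 < e := by lia
  rw [signedSum_eq_sum_quot he hB, Finset.sum_eq_single_of_mem i (Finset.mem_range.2 hi),
    charge_eq_signedSum (isBetaSet_quot he hB i)]
  · congr 1
    funext a
    rw [add_comm, Int.add_mul_emod_self_right, Int.emod_eq_of_lt (by lia) (by lia), if_pos rfl]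
    rfl
  · intro m hm hmi
    have hm := Finset.mem_range.1 hm
    have : ∀ a : ℤ, (a * (e : ℤ) + m) % e ≠ i := fun a => by
      rw [add_comm, Int.add_mul_emod_self_right, Int.emod_eq_of_lt (by lia) (by lia)]
      lia
    simp only [signedSum, if_neg (this _), mul_zero, finsum_zero]

theorem charge_eq_sum_quot {e : ℕ} (he : 0 < e) {B : Set ℤ} (hB : IsBetaSet B) :
    charge B = ∑ i ∈ Finset.range e, charge (quot e B i) := by
  rw [charge_eq_signedSum hB, signedSum_eq_sum_quot he hB]
  exact Finset.sum_congr rfl fun i _ => (charge_eq_signedSum (isBetaSet_quot he hB i)).symm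

/-! ### Cores -/

theorem quot_coreSet {e i : ℕ} (hi : i < e) (B : Set ℤ) :
    quot e (coreSet e B) i = Set.Iio (charge (quot e B i)) := by
  ext a
  constructor
  · rintro ⟨m, hm, c, hc, h⟩
    have h1 := congrArg (· % (e : ℤ)) h
    rw [add_comm, Int.add_mul_emod_self_right, add_comm (c * (e : ℤ)),
      Int.add_mul_emod_self_right, Int.emod_eq_of_lt (by lia) (by lia),
      Int.emod_eq_of_lt (by lia) (by lia)] at h1
    have h1 : i = m := by exact_mod_cast h1
    subst h1
    have : a = c := by
      have he : e ≠ 0 := by lia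
      simpa [he] using h
    exact this ▸ hc
  · intro h
    exact ⟨i, hi, a, h, rfl⟩

theorem charge_quot_coreSet {e i : ℕ} (hi : i < e) (B : Set ℤ) :
    charge (quot e (coreSet e B) i) = charge (quot e B i) := by
  rw [quot_coreSet hi, charge_Iio]

/-- A partition forgets the charge of its beta-set. Equal charges, which passing to cores preserves,
allow the core sets to be recovered from the partition. -/
theorem betaInv_coreSet_eq_iff {e : ℕ} (he : 0 < e) {B C : Set ℤ} (hB : IsBetaSet B)
    (hC : IsBetaSet C) (h : charge B = charge C) :
    betaInv (coreSet e B) = betaInv (coreSet e C) ↔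
      ∀ i < e, charge (quot e B i) = charge (quot e C i) := by
  have hch : ∀ {D : Set ℤ}, IsBetaSet D → charge (coreSet e D) = charge D := fun {D} hD => by
    rw [charge_eq_sum_quot he hD, charge_eq_sum_quot he (isBetaSet_coreSet he D)]
    exact Finset.sum_congr rfl fun i hi => charge_quot_coreSet (Finset.mem_range.1 hi) D
  constructor
  · intro heq i hi
    have h1 := beta_betaInv (isBetaSet_coreSet he B)
    rw [heq, hch hB, h, ← hch hC, beta_betaInv (isBetaSet_coreSet he C)] at h1
    rw [← charge_quot_coreSet hi B, ← h1, charge_quot_coreSet hi]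
  · intro heq
    congr 1
    ext x
    exact exists_congr fun i => and_congr_right fun hi => by rw [heq i hi]

/-! ### Uglov's map -/

/-- Bead `a` on runner `i` of component `j` goes to position `a * ℓ + j.rev` on runner `i`;
uniqueness of division by `e` and then by `ℓ` recovers `j` and `a`. -/
theorem quot_quot_uglov {e ℓ i : ℕ} (hi : i < e) (B : Fin ℓ → Set ℤ) (j : Fin ℓ) :
    quot ℓ (quot e (uglov e B) i) j.rev = quot e (B j) i := by
  have he : (0 : ℤ) < e := by lia
  have hup : ∀ (j : Fin ℓ) (x : ℤ),
      upsilon e ℓ j x = (x / e * ℓ + (j.rev : ℕ)) * e + x % e := fun j x => by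
    have h1 := Int.mul_ediv_add_emod x e
    have h2 : x - x % e = e * (x / e) := by lia
    have h3 : ((j.rev : ℕ) : ℤ) = ℓ - (j + 1) := by
      rw [Fin.val_rev]
      have := j.isLt
      push_cast [Nat.cast_sub (show (j : ℕ) + 1 ≤ ℓ by lia)]
      rfl
    rw [upsilon, h2, h3]
    ring
  have hdm : ∀ {n a b a' b' : ℤ}, 0 ≤ b → b < n → 0 ≤ b' → b' < n → a * n + b = a' * n + b' →
      a = a' ∧ b = b' := fun {n a b a' b'} h1 h2 h3 h4 h => by
    have hb := congrArg (· % n) h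
    rw [add_comm, Int.add_mul_emod_self_right, add_comm (a' * n), Int.add_mul_emod_self_right,
      Int.emod_eq_of_lt h1 h2, Int.emod_eq_of_lt h3 h4] at hb
    subst hb
    have hn : n ≠ 0 := by lia
    exact ⟨by simpa [hn] using h, rfl⟩
  ext a
  simp only [quot, uglov, Set.mem_ofPred_eq, Set.mem_iUnion, Set.mem_image, hup]
  constructor
  · rintro ⟨j', x, hx, h⟩
    obtain ⟨h1, h2⟩ := hdm (Int.emod_nonneg x he.ne') (Int.emod_lt_of_pos x he)
      (by lia) (by lia) h
    obtain ⟨h3, h4⟩ := hdm (by positivity) (by exact_mod_cast j'.rev.isLt) (by positivity)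
      (by exact_mod_cast j.rev.isLt) h1
    have h4 : j' = j := Fin.rev_injective (Fin.ext (by exact_mod_cast h4))
    subst h4
    rw [← h3, ← h2, mul_comm, Int.mul_ediv_add_emod]
    exact hx
  · intro h
    refine ⟨j, _, h, ?_⟩
    rw [add_comm (a * (e : ℤ)), Int.add_mul_ediv_right _ _ he.ne', Int.add_mul_emod_self_right,
      Int.ediv_eq_zero_of_lt (by lia) (by lia), Int.emod_eq_of_lt (by lia) (by lia), zero_add]

theorem signedSum_quot_uglov {e ℓ i : ℕ} (hi : i < e) (hl : 0 < ℓ) {B : Fin ℓ → Set ℤ}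
    (hB : ∀ j, IsBetaSet (B j)) (f : ℤ → ℤ) :
    signedSum (quot e (uglov e B) i) f =
      ∑ j : Fin ℓ, signedSum (quot e (B j) i) fun a => f (a * ℓ + (j.rev : ℕ)) := by
  have he : 0 < e := by lia
  rw [signedSum_eq_sum_quot hl (isBetaSet_quot he (isBetaSet_uglov he hl hB) i),
    ← Fin.sum_univ_eq_sum_range (fun m => signedSum (quot ℓ (quot e (uglov e B) i) m)
      fun a => f (a * ℓ + m)), ← Equiv.sum_comp Fin.revPerm]
  exact Finset.sum_congr rfl fun j _ => by
    rw [Fin.revPerm_apply, quot_quot_uglov hi]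

theorem charge_quot_uglov {e ℓ i : ℕ} (hi : i < e) (hl : 0 < ℓ) {B : Fin ℓ → Set ℤ}
    (hB : ∀ j, IsBetaSet (B j)) :
    charge (quot e (uglov e B) i) = ∑ j, charge (quot e (B j) i) := by
  have he : 0 < e := by lia
  rw [charge_eq_signedSum (isBetaSet_quot he (isBetaSet_uglov he hl hB) i),
    signedSum_quot_uglov hi hl hB]
  exact Finset.sum_congr rfl fun j _ => (charge_eq_signedSum (isBetaSet_quot he (hB j) i)).symm

theorem charge_uglov {e ℓ : ℕ} (he : 0 < e) (hl : 0 < ℓ) {B : Fin ℓ → Set ℤ}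
    (hB : ∀ j, IsBetaSet (B j)) : charge (uglov e B) = ∑ j, charge (B j) := by
  rw [charge_eq_sum_quot he (isBetaSet_uglov he hl hB),
    Finset.sum_congr rfl fun i hi => charge_quot_uglov (Finset.mem_range.1 hi) hl hB,
    Finset.sum_comm]
  exact Finset.sum_congr rfl fun j _ => (charge_eq_sum_quot he (hB j)).symm

/-- The label `a` of a bead `x` on its runner is `x / e`, so the runners of each component can be
glued back together. -/
theorem sum_signedSum_quot_uglov {e ℓ : ℕ} (he : 0 < e) (hl : 0 < ℓ) {B : Fin ℓ → Set ℤ}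
    (hB : ∀ j, IsBetaSet (B j)) :
    ∑ i ∈ Finset.range e, signedSum (quot e (uglov e B) i) id =
      ∑ j : Fin ℓ, signedSum (B j) fun x => x / e * ℓ + (j.rev : ℕ) := by
  rw [Finset.sum_congr rfl fun i hi => signedSum_quot_uglov (Finset.mem_range.1 hi) hl hB id,
    Finset.sum_comm]
  refine Finset.sum_congr rfl fun j _ => ?_
  rw [signedSum_eq_sum_quot he (hB j)]
  refine Finset.sum_congr rfl fun i hi => ?_
  have hi := Finset.mem_range.1 hi
  congr 1
  funext a
  rw [add_comm (a * (e : ℤ)), Int.add_mul_ediv_right _ _ (by lia),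
    Int.ediv_eq_zero_of_lt (by lia) (by lia), zero_add, id]

/-! ### Charges and weights in terms of residues -/

theorem sum_nodes_eq_count {e ℓ : ℕ} (lam : Fin ℓ → YoungDiagram) (t : Fin ℓ → ℤ) (z : ZMod e) :
    ∑ j, ∑ c ∈ (lam j).cells, (if (((c.2 : ℤ) - c.1 + t j : ℤ) : ZMod e) = z then (1 : ℤ) else 0) =
      (res e t lam).count z := by
  rw [res, Multiset.count_map, ← Finset.filter_val, Finset.card_val, Finset.card_filter, nodes,
    Finset.sum_sigma, Nat.cast_sum]
  refine Finset.sum_congr rfl fun j _ => ?_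
  rw [Nat.cast_sum]
  refine Finset.sum_congr rfl fun c _ => ?_
  simp only [nodeRes, eq_comm (a := z)]
  push_cast
  rfl

theorem charge_beta (t : ℤ) (lam : YoungDiagram) : charge (beta t lam) = t := by
  rw [charge_eq_signedSum (isBetaSet_beta t lam), signedSum_beta]
  simp [← charge_eq_signedSum (isBetaSet_Iio t), charge_Iio]

variable {e ℓ : ℕ}

theorem isBetaSet_uglovBeta (he : 0 < e) (hl : 0 < ℓ)
    (x : (Fin ℓ → YoungDiagram) × (Fin ℓ → ℤ)) : IsBetaSet (uglovBeta e x) :=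
  isBetaSet_uglov he hl fun _ => isBetaSet_beta _ _

theorem charge_uglovBeta (he : 0 < e) (hl : 0 < ℓ) (lam : Fin ℓ → YoungDiagram) (t : Fin ℓ → ℤ) :
    charge (uglovBeta e (lam, t)) = ∑ j, t j := by
  rw [uglovBeta, charge_uglov he hl fun _ => isBetaSet_beta _ _]
  exact Finset.sum_congr rfl fun j _ => charge_beta _ _

theorem emod_eq_iff_cast {i : ℕ} (hi : i < e) (y : ℤ) : y % e = i ↔ (y : ZMod e) = (i : ZMod e) := by
  have h : ((i : ℤ) : ZMod e) = (i : ZMod e) := by norm_cast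
  rw [← h, ZMod.intCast_eq_intCast_iff']
  rw [Int.emod_eq_of_lt (a := (i : ℤ)) (by lia) (by lia)]

/-- A node of residue `i` brings a bead onto runner `i`, and one of residue `i + 1` takes a bead
away from it. -/
theorem charge_quot_uglovBeta (hl : 0 < ℓ) {i : ℕ} (hi : i < e) (lam : Fin ℓ → YoungDiagram)
    (t : Fin ℓ → ℤ) :
    charge (quot e (uglovBeta e (lam, t)) i) =
      ∑ j, charge (quot e (Set.Iio (t j)) i) +
        ((res e t lam).count (i : ZMod e) - (res e t lam).count ((i : ZMod e) + 1)) := by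
  rw [uglovBeta, charge_quot_uglov hi hl fun _ => isBetaSet_beta _ _]
  simp only [charge_quot hi (isBetaSet_beta _ _), signedSum_beta,
    charge_quot hi (isBetaSet_Iio _), Finset.sum_add_distrib, Finset.sum_sub_distrib,
    emod_eq_iff_cast hi]
  rw [sum_nodes_eq_count, ← sum_nodes_eq_count _ _ ((i : ZMod e) + 1)]
  simp only [Int.cast_sub (R := ZMod e) _ 1, Int.cast_one, sub_eq_iff_eq_add]

theorem ediv_sub_ediv_sub_one (he : 0 < e) (y : ℤ) :
    y / e - (y - 1) / e = if (y : ZMod e) = 0 then 1 else 0 := by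
  have he' : (0 : ℤ) < e := by exact_mod_cast he
  have h0 := Int.emod_nonneg y he'.ne'
  have h1 := Int.emod_lt_of_pos y he'
  have h2 := Int.mul_ediv_add_emod y e
  have hz : (y : ZMod e) = 0 ↔ y % e = 0 := by
    rw [ZMod.intCast_zmod_eq_zero_iff_dvd, Int.dvd_iff_emod_eq_zero]
  simp only [hz]
  split_ifs with h
  · have : (y - 1) / e = y / e - 1 := by
      rw [show y - 1 = (e - 1 : ℤ) + (y / e - 1) * e by linear_combination -h2 + h,
        Int.add_mul_ediv_right _ _ he'.ne', Int.ediv_eq_zero_of_lt (by lia) (by lia), zero_add]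
    rw [this]
    ring
  · have : (y - 1) / e = y / e := by
      rw [show y - 1 = (y % e - 1 : ℤ) + (y / e) * e by linear_combination -h2,
        Int.add_mul_ediv_right _ _ he'.ne', Int.ediv_eq_zero_of_lt (by lia) (by lia), zero_add]
    rw [this]
    ring

/-- The position function has slope `ℓ` in `x / e`, which jumps only at multiples of `e`, so only
nodes of residue `0` count. -/
theorem wt_eq (he : 0 < e) (hl : 0 < ℓ) (lam : Fin ℓ → YoungDiagram) (t : Fin ℓ → ℤ) :
    wt e (lam, t) = ∑ j : Fin ℓ, signedSum (Set.Iio (t j)) (fun x => x / e * ℓ + (j.rev : ℕ)) +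
      ℓ * (res e t lam).count 0 -
      ∑ i ∈ Finset.range e,
        signedSum (Set.Iio (charge (quot e (uglovBeta e (lam, t)) i))) id := by
  rw [wt, wtSet_eq he (isBetaSet_uglovBeta he hl _)]
  congr 1
  rw [uglovBeta, sum_signedSum_quot_uglov he hl fun _ => isBetaSet_beta _ _]
  simp only [signedSum_beta, Finset.sum_add_distrib]
  congr 1
  rw [← sum_nodes_eq_count, Finset.mul_sum]
  refine Finset.sum_congr rfl fun j _ => ?_
  rw [Finset.mul_sum]
  refine Finset.sum_congr rfl fun c _ => ?_
  rw [← ediv_sub_ediv_sub_one he]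
  ring

theorem wt_nonneg (he : 0 < e) (hl : 0 < ℓ) (x : (Fin ℓ → YoungDiagram) × (Fin ℓ → ℤ)) :
    0 ≤ wt e x :=
  wtSet_nonneg he (isBetaSet_uglovBeta he hl x)

theorem core_eq_iff (he : 0 < e) (hl : 0 < ℓ) (lam mu : Fin ℓ → YoungDiagram) (t : Fin ℓ → ℤ) :
    core e (lam, t) = core e (mu, t) ↔ ∀ i < e,
      ((res e t lam).count (i : ZMod e) : ℤ) - (res e t lam).count ((i : ZMod e) + 1) =
        (res e t mu).count (i : ZMod e) - (res e t mu).count ((i : ZMod e) + 1) := by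
  rw [core, core, betaInv_coreSet_eq_iff he (isBetaSet_uglovBeta he hl _)
    (isBetaSet_uglovBeta he hl _) (by rw [charge_uglovBeta he hl, charge_uglovBeta he hl])]
  refine forall₂_congr fun i hi => ?_
  rw [charge_quot_uglovBeta hl hi, charge_quot_uglovBeta hl hi, add_right_inj]

theorem wt_sub_wt (he : 0 < e) (hl : 0 < ℓ) {lam mu : Fin ℓ → YoungDiagram} {t : Fin ℓ → ℤ}
    (h : core e (lam, t) = core e (mu, t)) :
    wt e (lam, t) - wt e (mu, t) =
      ℓ * ((res e t lam).count 0 - (res e t mu).count 0) := by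
  rw [core_eq_iff he hl] at h
  have hs : ∑ i ∈ Finset.range e,
        signedSum (Set.Iio (charge (quot e (uglovBeta e (lam, t)) i))) id =
      ∑ i ∈ Finset.range e,
        signedSum (Set.Iio (charge (quot e (uglovBeta e (mu, t)) i))) id :=
    Finset.sum_congr rfl fun i hi => by
      have hi := Finset.mem_range.1 hi
      rw [charge_quot_uglovBeta hl hi, charge_quot_uglovBeta hl hi, h i hi]
  rw [wt_eq he hl, wt_eq he hl, hs]
  ring

/-! ### The action of the extended affine Weyl group -/

/-- Components and charges are permuted together, and translations by multiples of `e` vanish in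
`ZMod e`. -/
theorem count_res_act (x : (Fin ℓ → YoungDiagram) × (Fin ℓ → ℤ)) (w : ExtAffineWeyl ℓ)
    (z : ZMod e) :
    (res e (act e x w).2 (act e x w).1).count z = (res e x.2 x.1).count z := by
  have h : ((res e (act e x w).2 (act e x w).1).count z : ℤ) = (res e x.2 x.1).count z := by
    rw [← sum_nodes_eq_count, ← sum_nodes_eq_count, ← Equiv.sum_comp w.right (fun j =>
      ∑ c ∈ (x.1 j).cells, if (((c.2 : ℤ) - c.1 + x.2 j : ℤ) : ZMod e) = z then (1 : ℤ) else 0)]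
    simp [act]
  exact_mod_cast h

theorem core_act_eq (he : 0 < e) (hl : 0 < ℓ) {lam mu : Fin ℓ → YoungDiagram} {t : Fin ℓ → ℤ}
    (h : core e (lam, t) = core e (mu, t)) (w : ExtAffineWeyl ℓ) :
    core e (act e (lam, t) w) = core e (act e (mu, t) w) := by
  refine (core_eq_iff he hl (act e (lam, t) w).1 (act e (mu, t) w).1 (act e (lam, t) w).2).2
    fun i hi => ?_
  have h1 := fun z => count_res_act (e := e) (lam, t) w z
  have h2 := fun z => count_res_act (e := e) (mu, t) w z
  -- The new charge depends only on `t` and `w`, so the fixed-charge criterion still applies.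
  have h3 : (act e (lam, t) w).2 = (act e (mu, t) w).2 := rfl
  rw [h1, h1, h3, h2, h2]
  exact (core_eq_iff he hl lam mu t).1 h i hi

theorem wt_act_sub_wt_act (he : 0 < e) (hl : 0 < ℓ) {lam mu : Fin ℓ → YoungDiagram}
    {t : Fin ℓ → ℤ} (h : core e (lam, t) = core e (mu, t)) (w : ExtAffineWeyl ℓ) :
    wt e (act e (lam, t) w) - wt e (act e (mu, t) w) =
      ℓ * ((res e t lam).count 0 - (res e t mu).count 0) := by
  have h1 := wt_sub_wt (lam := (act e (lam, t) w).1) (mu := (act e (mu, t) w).1)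
    (t := (act e (lam, t) w).2) he hl (core_act_eq he hl h w)
  have h3 : (act e (lam, t) w).2 = (act e (mu, t) w).2 := rfl
  rw [count_res_act, h3, count_res_act] at h1
  exact h1

theorem exists_isLeast_wt_orbit (he : 0 < e) (hl : 0 < ℓ)
    (x : (Fin ℓ → YoungDiagram) × (Fin ℓ → ℤ)) : ∃ w, IsLeast (wt e '' orbit e x) w := by
  obtain ⟨m, hm, h⟩ := Int.exists_least_of_bdd (P := fun z => z ∈ wt e '' orbit e x)
    ⟨0, by rintro _ ⟨y, -, rfl⟩; exact wt_nonneg he hl y⟩ ⟨_, _, ⟨1, rfl⟩, rfl⟩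
  exact ⟨m, hm, fun z hz => h z hz⟩

theorem isLeast_wt_orbit_add {x y : (Fin ℓ → YoungDiagram) × (Fin ℓ → ℤ)} {d m : ℤ}
    (h : ∀ w, wt e (act e x w) - wt e (act e y w) = d) (hm : IsLeast (wt e '' orbit e y) m) :
    IsLeast (wt e '' orbit e x) (m + d) := by
  obtain ⟨⟨_, ⟨w, rfl⟩, rfl⟩, hlow⟩ := hm
  refine ⟨⟨_, ⟨w, rfl⟩, by have := h w; lia⟩, ?_⟩
  rintro _ ⟨_, ⟨v, rfl⟩, rfl⟩
  have h1 := hlow ⟨_, ⟨v, rfl⟩, rfl⟩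
  have h2 := h v
  lia

theorem count_eq_of_core_eq (he : 0 < e) (hl : 0 < ℓ) {lam mu : Fin ℓ → YoungDiagram}
    {t : Fin ℓ → ℤ} (h : core e (lam, t) = core e (mu, t))
    (h0 : (res e t lam).count 0 = (res e t mu).count 0) : res e t lam = res e t mu := by
  rw [core_eq_iff he hl] at h
  -- The core fixes each difference of consecutive counts, so equality propagates around the cycle
  -- from residue `0`.
  have key : ∀ i ≤ e, (res e t lam).count (i : ZMod e) = (res e t mu).count (i : ZMod e) := by
    intro i
    induction i with
    | zero => simpa using h0
    | succ i ih =>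
      intro hi
      have h1 := h i (by lia)
      have h2 := ih (by lia)
      push_cast
      lia
  have : NeZero e := ⟨he.ne'⟩
  refine Multiset.ext.2 fun z => ?_
  have := key z.val (ZMod.val_lt z).le
  rwa [ZMod.natCast_zmod_val] at this

end Uglov

theorem theorem4p2 (e ℓ : ℕ) (he : 2 ≤ e) (hl : 1 ≤ ℓ) (r : Fin ℓ → ℤ)
    (lam mu : Fin ℓ → YoungDiagram) :
    Uglov.res e r lam = Uglov.res e r mu ↔
      Uglov.core e (lam, r) = Uglov.core e (mu, r) ∧
      ∃ w : ℤ, IsLeast (Uglov.wt e '' Uglov.orbit e (lam, r)) w ∧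
        IsLeast (Uglov.wt e '' Uglov.orbit e (mu, r)) w := by
  have he0 : 0 < e := by lia
  have hmin := fun h : Uglov.core e (lam, r) = Uglov.core e (mu, r) => fun m =>
    Uglov.isLeast_wt_orbit_add (m := m) (Uglov.wt_act_sub_wt_act he0 hl h)
  constructor
  · intro h
    have hcore : Uglov.core e (lam, r) = Uglov.core e (mu, r) :=
      (Uglov.core_eq_iff he0 hl lam mu r).2 fun i _ => by rw [h]
    obtain ⟨m, hm⟩ := Uglov.exists_isLeast_wt_orbit he0 hl (mu, r)
    refine ⟨hcore, m, ?_, hm⟩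
    simpa [h] using hmin hcore m hm
  · rintro ⟨hcore, m, h1, h2⟩
    refine Uglov.count_eq_of_core_eq he0 hl hcore ?_
    -- For the orbit of `lam`, both `m` and `m` plus `ℓ` times the difference of the `0`-counts are
    -- least; cancelling `ℓ` equates the `0`-counts.
    have h3 := h1.unique (hmin hcore m h2)
    have hl' : (ℓ : ℤ) ≠ 0 := by lia
    have h4 := (mul_eq_zero.1 (left_eq_add.1 h3)).resolve_left hl'
    exact_mod_cast sub_eq_zero.1 h4
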